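/- Identify $\mathbb C^n$ with $\mathbb R^{2n}$ in the standard way. For a set $K\subset\mathbb C^n$ with the origin in its interior let $\|z\|_K=\inf\{a>0: z\in aK\}$ be its Minkowski functional. A \emph{convex body} is a compact convex set with non-empty interior. A \emph{star body} is a compact set $K$ with the origin in its interior such that every straight line through the origin meets the boundary of $K$ in exactly two points and $\|\cdot\|_K$ is continuous. A convex (star) body $K$ is called \emph{origin-symmetric complex} if $K=-K$ and $\|e^{i\theta}z\|_K=\|z\|_K$ for all $\theta\in\mathbb R$, $z\in\mathbb C^n$; thus the origin-symmetric complex convex bodies are the closed unit balls of the norms on the complex vector space $\mathbb C^n$. For $\xi\in\mathbb C^n$ with $|\xi|=1$ let $H_\xi=\{z\in\mathbb C^n:\sum_{k=1}^n z_k\overline{\xi_k}=0\}$, and let $H_\xi^\perp$ be its orthogonal complement. For origin-symmetric complex star bodies $K,L$ in $\mathbb C^n$, $L$ is called the \emph{complex intersection body} of $K$, written $L=I_c(K)$, if $$|L\cap H_\xi^\perp| = |K\cap H_\xi|\qquad\text{for all }\xi\in\mathbb C^n,\ |\xi|=1,$$ where $|\cdot|$ denotes Lebesgue volume of dimension $2$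 on the left and of dimension $2n-2$ on the right (for $n=1$ a point has volume $1$). \textbf{Theorem (complex Busemann theorem).} Let $K$ be an origin-symmetric complex convex body in $\mathbb C^n$. Then the complex intersection body $I_c(K)$ exists and is unique, and it is again an origin-symmetric complex convex body in $\mathbb C^n$. -/

import Mathlib

open MeasureTheory

noncomputable section

namespace ComplexBody

/-- `ℂⁿ` with its Hermitian inner product. As a real inner product space (with the inner product
`Re ⟪z, w⟫`) it is `ℝ²ⁿ` with its Euclidean structure, under the standard identification. -/
abbrev Cn (n : ℕ) : Type := EuclideanSpace ℂ (Fin n)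

variable {n : ℕ}

/-- A convex body: a compact convex set with non-empty interior. -/
structure IsConvexBody (K : Set (Cn n)) : Prop where
  convex : Convex ℝ K
  isCompact : IsCompact K
  interior_nonempty : (interior K).Nonempty

/-- A star body: a compact set with the origin in its interior, such that every straight line
through the origin crosses the boundary at exactly two points, and whose Minkowski functional is
continuous. -/
structure IsStarBody (K : Set (Cn n)) : Prop where
  isCompact : IsCompact K
  zero_mem_interior : (0 : Cn n) ∈ interior K
  line_frontier : ∀ x : Cn n, x ≠ 0 → {t : ℝ | t • x ∈ frontier K}.ncard = 2
  continuous_gauge : Continuous (gauge K)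

/-- Symmetry with respect to the origin. -/
def IsOriginSymmetric (K : Set (Cn n)) : Prop :=
  ∀ z ∈ K, -z ∈ K

/-- The Minkowski functional of `K` is invariant under the simultaneous rotation of all the
coordinates by the same angle, that is, under multiplication by `exp (i θ)`. -/
def IsRotationInvariant (K : Set (Cn n)) : Prop :=
  ∀ (θ : ℝ) (z : Cn n), gauge K (Complex.exp (θ * Complex.I) • z) = gauge K z

/-- Origin symmetric complex convex bodies. -/
structure IsSymmComplexConvexBody (K : Set (Cn n)) : Prop where
  isConvexBody : IsConvexBody K
  symm : IsOriginSymmetric K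
  rotation : IsRotationInvariant K

/-- Origin symmetric complex star bodies. -/
structure IsSymmComplexStarBody (K : Set (Cn n)) : Prop where
  isStarBody : IsStarBody K
  symm : IsOriginSymmetric K
  rotation : IsRotationInvariant K

/-- The complex hyperplane `H_ξ = {z | ∑ k, z k * conj (ξ k) = 0}` (for `ξ ≠ 0`). -/
def hyperplane (ξ : Cn n) : Submodule ℂ (Cn n) where
  carrier := {z | ∑ k, z k * (starRingEnd ℂ) (ξ k) = 0}
  zero_mem' := by simp
  add_mem' := by
    intro a b ha hb
    simp only [Set.mem_ofPred_eq] at ha hb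
    simp [add_mul, Finset.sum_add_distrib, ha, hb]
  smul_mem' := by
    intro c a ha
    simp only [Set.mem_ofPred_eq] at ha
    simp [mul_assoc, ← Finset.mul_sum, ha]

/-- The volume of `K ∩ H` in the subspace `H`, in the real dimension of `H`: the Lebesgue measure
of the Euclidean space `H`, for which the cube on an orthonormal basis over `ℝ` has volume `1`. -/
def sectionVolume (K : Set (Cn n)) (H : Submodule ℂ (Cn n)) : ENNReal :=
  volume {z : H.restrictScalars ℝ | (z : Cn n) ∈ K}

/-- `L` is the complex intersection body of `K`: both are origin symmetric complex star bodies, and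
`|L ∩ H_ξ^⊥| = |K ∩ H_ξ|` for every unit vector `ξ`. -/
structure IsComplexIntersectionBodyOf (L K : Set (Cn n)) : Prop where
  left : IsSymmComplexStarBody L
  right : IsSymmComplexStarBody K
  volume_eq : ∀ ξ : Cn n, ‖ξ‖ = 1 →
    sectionVolume L (hyperplane ξ)ᗮ = sectionVolume K (hyperplane ξ)

end ComplexBody

end

noncomputable section

namespace ComplexBody

open scoped Pointwise

/-! By rotation invariance `L ∩ H_ξ^⊥` is a disc of radius 1/‖ξ‖_L for unit ξ. The defining equation
therefore forces ‖ξ‖_L = |ξ| (π/|K ∩ H_ξ|)^(1/2), which is `sectionNorm`. Uniqueness follows, and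
the core of what remains is the triangle inequality for this function.

Two vectors lie in a complex plane with an orthonormal basis a, b (for n ≥ 2). Let E be the
orthogonal complement of that plane, of real dimension d. For a unit ξ in the plane, H_ξ = ℂη ⊕ E,
where η is a unit vector of the plane orthogonal to ξ. Slicing along zη and absorbing the phase of z
into E, with N the norm of K, gives |K ∩ H_ξ| = c_d ∫_E N(η + e)^(-(d+2)) de (`volume_section`).
Since η can be chosen to depend real-linearly on ξ, it suffices that u ↦ (∫_E N(u + e)^(-(d+2))
de)^(-1/2) is a real norm on the plane.

This last fact no longer uses the complex structure. It is proved one real variable at a time: if p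
is a norm, so is x ↦ (∫ p(x,t)^(-(k+1)) dt)^(-1/k) (`exists_marginal`). The triangle inequality
there is a Borell–Brascamp–Lieb inequality on the line (`le_lintegral_of_add_le`), obtained from
monotone transport and Jensen. After d steps the exponent has dropped from d+2 to 2, which matches
the square root in `sectionNorm`. -/

/-! ### Transport and a Borell–Brascamp–Lieb inequality on the line -/

/-- Monotone transport between two positive continuous integrable densities on the line, normalised
to have the same mass. -/
theorem exists_transport {f g : ℝ → ℝ} (hf : Continuous f) (hg : Continuous g)
    (hf0 : ∀ t, 0 < f t) (hg0 : ∀ t, 0 < g t) (hfi : Integrable f) (hgi : Integrable g) :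
    ∃ T : ℝ → ℝ, StrictMono T ∧
      ∀ a, HasDerivAt T (((∫ t, g t) * f a) / ((∫ t, f t) * g (T a))) a := by
  have cdf : ∀ {f : ℝ → ℝ}, Continuous f → (∀ t, 0 < f t) → Integrable f →
      StrictMono (fun a => ∫ t in Set.Iic a, f t) ∧
      (∀ a, HasDerivAt (fun a => ∫ t in Set.Iic a, f t) (f a) a) ∧
      Filter.Tendsto (fun a => ∫ t in Set.Iic a, f t) Filter.atTop (nhds (∫ t, f t)) ∧
      Filter.Tendsto (fun a => ∫ t in Set.Iic a, f t) Filter.atBot (nhds 0) := by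
    intro f hf hf0 hfi
    have hd : ∀ a, HasDerivAt (fun a => ∫ t in Set.Iic a, f t) (f a) a := by
      intro a
      have h1 : (fun b => ∫ t in Set.Iic b, f t) =
          fun b => (∫ t in Set.Iic 0, f t) + ∫ t in (0 : ℝ)..b, f t := by
        ext b
        have := intervalIntegral.integral_Iic_sub_Iic (f := f) (μ := volume) (a := 0) (b := b)
          hfi.integrableOn hfi.integrableOn
        linarith
      rw [h1]
      exact (intervalIntegral.integral_hasDerivAt_right (hf.intervalIntegrable _ _)
        (hf.stronglyMeasurableAtFilter _ _) hf.continuousAt).const_add _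
    refine ⟨strictMono_of_hasDerivAt_pos hd hf0, hd, ?_, ?_⟩
    · have := (aecover_Iic (μ := volume) (Filter.tendsto_id (α := ℝ)
        (x := Filter.atTop))).integral_tendsto_of_countably_generated hfi
      simpa using this
    · have h2 := (aecover_Ioi (μ := volume) (Filter.tendsto_id (α := ℝ)
        (x := Filter.atBot))).integral_tendsto_of_countably_generated hfi
      have h3 : ∀ a, ∫ t in Set.Iic a, f t = (∫ t, f t) - ∫ t in Set.Ioi a, f t := by
        intro a
        have := integral_add_compl (μ := volume) (measurableSet_Iic (a := a)) hfi
        rw [Set.compl_Iic] at this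
        linarith
      simp_rw [h3]
      simpa using h2.const_sub (∫ t, f t)
  obtain ⟨mF, dF, tF, bF⟩ := cdf hf hf0 hfi
  obtain ⟨mG, dG, tG, bG⟩ := cdf hg hg0 hgi
  set F := fun a => ∫ t in Set.Iic a, f t
  set G := fun a => ∫ t in Set.Iic a, g t
  set A := ∫ t, f t
  set B := ∫ t, g t
  have hpos : ∀ {F : ℝ → ℝ} {A : ℝ}, StrictMono F → Filter.Tendsto F Filter.atTop (nhds A) →
      Filter.Tendsto F Filter.atBot (nhds 0) → ∀ a, 0 < F a ∧ F a < A := by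
    intro F A m t b a
    exact ⟨lt_of_le_of_lt (m.monotone.le_of_tendsto b (a - 1)) (m (by linarith)),
      lt_of_lt_of_le (m (show a < a + 1 by linarith)) (m.monotone.ge_of_tendsto t (a + 1))⟩
  have hFp := hpos mF tF bF
  have hGp := hpos mG tG bG
  have hA : 0 < A := (hFp 0).1.trans (hFp 0).2
  have hB : 0 < B := (hGp 0).1.trans (hGp 0).2
  have cG : Continuous G := continuous_iff_continuousAt.2 fun a => (dG a).continuousAt
  have cF : Continuous F := continuous_iff_continuousAt.2 fun a => (dF a).continuousAt
  -- The transport map is defined by equating normalised distribution functions. The target value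
  -- lies strictly between the limits 0 and B of G, so it is attained.
  have hT : ∀ a, ∃ b, G b = B / A * F a := by
    intro a
    have h1 : 0 < B / A * F a := mul_pos (div_pos hB hA) (hFp a).1
    have h2 : B / A * F a < B := by
      rw [div_mul_eq_mul_div, div_lt_iff₀ hA]
      exact mul_lt_mul_of_pos_left (hFp a).2 hB
    obtain ⟨b, hb⟩ := (bG.eventually (gt_mem_nhds h1)).exists
    obtain ⟨c, hc⟩ := (tG.eventually (lt_mem_nhds h2)).exists
    exact mem_range_of_exists_le_of_exists_ge cG ⟨b, hb.le⟩ ⟨c, hc.le⟩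
  choose T hT using hT
  have mT : StrictMono T := by
    intro a b hab
    rw [← mG.lt_iff_lt, hT, hT]
    exact mul_lt_mul_of_pos_left (mF hab) (div_pos hB hA)
  have eG : Topology.IsEmbedding G :=
    mG.isEmbedding_of_ordConnected (isPreconnected_range cG).ordConnected
  have cT : Continuous T := by
    rw [eG.isInducing.continuous_iff]
    have : G ∘ T = fun a => B / A * F a := funext hT
    rw [this]
    exact continuous_const.mul cF
  refine ⟨T, mT, fun a => ?_⟩
  -- the slope of `T` comes from inverting `G` locally
  have h1 := hasDerivAt_iff_tendsto_slope.1 (dG (T a))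
  have h2 := hasDerivAt_iff_tendsto_slope.1 ((dF a).const_mul (B / A))
  rw [hasDerivAt_iff_tendsto_slope]
  have tT : Filter.Tendsto T (nhdsWithin a {a}ᶜ) (nhdsWithin (T a) {T a}ᶜ) :=
    tendsto_nhdsWithin_iff.2 ⟨(cT.tendsto a).mono_left nhdsWithin_le_nhds,
      eventually_nhdsWithin_of_forall fun b hb => by simpa using mT.injective.ne hb⟩
  have h3 := h2.div (h1.comp tT) (hg0 _).ne'
  have e : B / A * f a / g (T a) = B * f a / (A * g (T a)) := by
    have := (hg0 (T a)).ne'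
    field_simp
  rw [e] at h3
  refine h3.congr' (eventually_nhdsWithin_of_forall fun b hb => ?_)
  have hb' : T b - T a ≠ 0 := sub_ne_zero.2 (mT.injective.ne hb)
  have hb2 : b - a ≠ 0 := sub_ne_zero.2 hb
  have hb3 : G (T b) - G (T a) ≠ 0 := sub_ne_zero.2 (mG.injective.ne (mT.injective.ne hb))
  have hb4 : B / A * F b - B / A * F a = G (T b) - G (T a) := by rw [hT, hT]
  simp only [Function.comp, slope_def_field, hb4, Pi.div_apply]
  field_simp

/-- Jensen's inequality for powers, with unnormalised weights. -/
theorem add_pow_succ_le {u v α β : ℝ} (hu : 0 ≤ u) (hv : 0 ≤ v) (hα : 0 < α) (hβ : 0 < β) (k : ℕ) :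
    (u + v) ^ (k + 1) ≤ (u ^ (k + 1) / α ^ k + v ^ (k + 1) / β ^ k) * (α + β) ^ k := by
  have hs : 0 < α + β := add_pos hα hβ
  have h := (convexOn_pow (k + 1)).2 (Set.mem_Ici.2 (div_nonneg hu hα.le))
    (Set.mem_Ici.2 (div_nonneg hv hβ.le)) (div_nonneg hα.le hs.le) (div_nonneg hβ.le hs.le)
    (by field_simp)
  have e1 : α / (α + β) * (u / α) + β / (α + β) * (v / β) = (u + v) / (α + β) := by field_simp
  simp only [smul_eq_mul] at h
  rw [e1, div_pow, div_le_iff₀ (pow_pos hs _)] at h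
  refine h.trans (le_of_eq ?_)
  rw [div_pow, div_pow]
  field_simp
  ring

/-- A Borell–Brascamp–Lieb inequality on the line, for the exponent `-1 / (k + 1)`. -/
theorem le_lintegral_of_add_le {u v w : ℝ → ℝ} (hu : Continuous u) (hv : Continuous v)
    (hu0 : ∀ t, 0 < u t) (hv0 : ∀ t, 0 < v t) (hw0 : ∀ t, 0 < w t)
    (hadd : ∀ a b, w (a + b) ≤ u a + v b) (k : ℕ) {α β : ℝ} (hα : 0 < α) (hβ : 0 < β)
    (hui : Integrable fun t => (u t ^ (k + 1))⁻¹) (hvi : Integrable fun t => (v t ^ (k + 1))⁻¹)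
    (hα' : ∫ t, (u t ^ (k + 1))⁻¹ = (α ^ k)⁻¹) (hβ' : ∫ t, (v t ^ (k + 1))⁻¹ = (β ^ k)⁻¹) :
    ENNReal.ofReal (((α + β) ^ k)⁻¹) ≤ ∫⁻ t, ENNReal.ofReal ((w t ^ (k + 1))⁻¹) := by
  have hu1 : ∀ t, 0 < (u t ^ (k + 1))⁻¹ := fun t => inv_pos.2 (pow_pos (hu0 t) _)
  have hv1 : ∀ t, 0 < (v t ^ (k + 1))⁻¹ := fun t => inv_pos.2 (pow_pos (hv0 t) _)
  obtain ⟨T, mT, dT⟩ := exists_transport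
    (f := fun t => (u t ^ (k + 1))⁻¹) (g := fun t => (v t ^ (k + 1))⁻¹)
    ((hu.pow _).inv₀ fun t => (pow_pos (hu0 t) _).ne')
    ((hv.pow _).inv₀ fun t => (pow_pos (hv0 t) _).ne')
    hu1 hv1 hui hvi
  rw [hα', hβ'] at dT
  have mS : StrictMono fun a => a + T a := strictMono_id.add mT
  have hcv := lintegral_image_eq_lintegral_abs_deriv_mul (s := Set.univ) MeasurableSet.univ
    (fun a _ => ((hasDerivAt_id a).add (dT a)).hasDerivWithinAt) mS.injective.injOn
    (fun t => ENNReal.ofReal ((w t ^ (k + 1))⁻¹))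
  -- Only a lower bound is wanted, so integrating over the image of a ↦ a + T a is enough and
  -- surjectivity is not needed.
  refine le_trans ?_ (setLIntegral_le_lintegral _ _ |>.trans' hcv.ge)
  rw [setLIntegral_univ]
  have hC : 0 ≤ ((α + β) ^ k)⁻¹ * α ^ k := by positivity
  calc ENNReal.ofReal (((α + β) ^ k)⁻¹)
      = ENNReal.ofReal (((α + β) ^ k)⁻¹ * α ^ k * ∫ t, (u t ^ (k + 1))⁻¹) := by
        rw [hα']
        congr 1
        field_simp
    _ = ENNReal.ofReal (∫ t, ((α + β) ^ k)⁻¹ * α ^ k * (u t ^ (k + 1))⁻¹) := by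
        rw [integral_const_mul]
    _ = ∫⁻ t, ENNReal.ofReal (((α + β) ^ k)⁻¹ * α ^ k * (u t ^ (k + 1))⁻¹) :=
        ofReal_integral_eq_lintegral_ofReal (hui.const_mul _)
          (Filter.Eventually.of_forall fun t => mul_nonneg hC (hu1 t).le)
    _ ≤ _ := by
        refine lintegral_mono fun a => ?_
        rw [← ENNReal.ofReal_mul (abs_nonneg _)]
        refine ENNReal.ofReal_le_ofReal ?_
        have hua := hu0 a
        have hva := hv0 (T a)
        have hwa := hw0 (a + T a)
        have hnn : 0 ≤ (β ^ k)⁻¹ * (u a ^ (k + 1))⁻¹ / ((α ^ k)⁻¹ * (v (T a) ^ (k + 1))⁻¹) := by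
          positivity
        rw [abs_of_nonneg (by simpa using add_nonneg zero_le_one hnn)]
        have h1 : ((u a + v (T a)) ^ (k + 1))⁻¹ ≤ (w (a + T a) ^ (k + 1))⁻¹ := by
          have := hadd a (T a)
          gcongr
        refine le_trans ?_ (mul_le_mul_of_nonneg_left h1 (by positivity))
        -- The Jacobian 1 + T' equals (α^k / u^(k+1)) (u^(k+1)/α^k + v^(k+1)/β^k); its second factor
        -- is the one in Jensen's inequality.
        have h2 := add_pow_succ_le hua.le hva.le hα hβ k
        rw [← div_eq_mul_inv _ ((u a + v (T a)) ^ (k + 1)), le_div_iff₀ (by positivity)]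
        calc ((α + β) ^ k)⁻¹ * α ^ k * (u a ^ (k + 1))⁻¹ * (u a + v (T a)) ^ (k + 1)
            ≤ ((α + β) ^ k)⁻¹ * α ^ k * (u a ^ (k + 1))⁻¹ *
              ((u a ^ (k + 1) / α ^ k + v (T a) ^ (k + 1) / β ^ k) * (α + β) ^ k) := by gcongr
          _ = _ := by
            field_simp

/-! ### Real norms and their marginals -/

/-- A function with the properties of a norm on a real vector space. -/
structure IsNormLike {V : Type*} [AddCommGroup V] [Module ℝ V] (p : V → ℝ) : Prop where
  add_le : ∀ x y, p (x + y) ≤ p x + p y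
  smul : ∀ (t : ℝ) (x : V), p (t • x) = |t| * p x
  pos : ∀ x, x ≠ 0 → 0 < p x

namespace IsNormLike

section

variable {V W : Type*} [AddCommGroup V] [Module ℝ V] [AddCommGroup W] [Module ℝ W] {p : V → ℝ}

theorem map_zero (hp : IsNormLike p) : p 0 = 0 := by
  simpa using hp.smul 0 0

theorem nonneg (hp : IsNormLike p) (x : V) : 0 ≤ p x := by
  by_cases h : x = 0
  · rw [h, hp.map_zero]
  · exact (hp.pos x h).le

theorem comp_linearMap (hp : IsNormLike p) (f : W →ₗ[ℝ] V) (hf : Function.Injective f) :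
    IsNormLike fun x => p (f x) where
  add_le x y := by simpa using hp.add_le (f x) (f y)
  smul t x := by simpa using hp.smul t (f x)
  pos x hx := hp.pos _ fun h => hx (hf (by simpa using h))

theorem const_mul (hp : IsNormLike p) {c : ℝ} (hc : 0 < c) : IsNormLike fun x => c * p x where
  add_le x y := by
    rw [← mul_add]
    exact mul_le_mul_of_nonneg_left (hp.add_le x y) hc.le
  smul t x := by rw [hp.smul]; ring
  pos x hx := mul_pos hc (hp.pos x hx)

theorem convexOn (hp : IsNormLike p) : ConvexOn ℝ Set.univ p := by
  refine ⟨convex_univ, fun x _ y _ a b ha hb _ => ?_⟩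
  refine (hp.add_le _ _).trans ?_
  rw [hp.smul, hp.smul, abs_of_nonneg ha, abs_of_nonneg hb]
  rfl

end

section

variable {V : Type*} [NormedAddCommGroup V] [NormedSpace ℝ V] [FiniteDimensional ℝ V] {p : V → ℝ}

theorem continuous (hp : IsNormLike p) : Continuous p :=
  hp.convexOn.locallyLipschitz.continuous

theorem exists_mul_norm_le (hp : IsNormLike p) : ∃ c, 0 < c ∧ ∀ x, c * ‖x‖ ≤ p x := by
  have : ProperSpace V := FiniteDimensional.proper_real V
  rcases subsingleton_or_nontrivial V with hV | hV
  · refine ⟨1, one_pos, fun x => ?_⟩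
    rw [Subsingleton.elim x 0, hp.map_zero, norm_zero, mul_zero]
  · obtain ⟨x₀, hx₀, hmin⟩ := (isCompact_sphere (0 : V) 1).exists_isMinOn
      (NormedSpace.sphere_nonempty.2 zero_le_one) hp.continuous.continuousOn
    have hx1 : x₀ ≠ 0 := by
      rintro rfl
      simp at hx₀
    refine ⟨p x₀, hp.pos _ hx1, fun x => ?_⟩
    by_cases hx : x = 0
    · rw [hx, hp.map_zero, norm_zero, mul_zero]
    · have hn : 0 < ‖x‖ := norm_pos_iff.2 hx
      have h := hmin (a := ‖x‖⁻¹ • x) (by simp [norm_smul, hn.ne'])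
      simp only [Set.mem_ofPred_eq, hp.smul, abs_inv, abs_norm] at h
      rwa [le_inv_mul_iff₀' hn] at h

end

section

variable {X : Type*} [NormedAddCommGroup X] [NormedSpace ℝ X] [FiniteDimensional ℝ X]
  {p : X × ℝ → ℝ}

theorem continuous_inv_pow (hp : IsNormLike p) (k : ℕ) {x : X} (hx : x ≠ 0) :
    Continuous fun t : ℝ => (p (x, t) ^ k)⁻¹ :=
  ((hp.continuous.comp (Continuous.prodMk_right x)).pow k).inv₀ fun t =>
    (pow_pos (hp.pos (x, t) (by simp [hx])) k).ne'

theorem integrable_inv_pow (hp : IsNormLike p) {k : ℕ} (hk : k ≠ 0) {x : X} (hx : x ≠ 0) :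
    Integrable fun t : ℝ => (p (x, t) ^ (k + 1))⁻¹ := by
  obtain ⟨c, hc, hcp⟩ := hp.exists_mul_norm_le
  obtain ⟨j, rfl⟩ := Nat.exists_eq_succ_of_ne_zero hk
  have hxn : 0 < ‖x‖ := norm_pos_iff.2 hx
  -- The sup norm of (x, t) dominates both ‖x‖ and |t|, so this δ gives δ(1 + t²) ≤ ‖(x, t)‖². The
  -- exponent is at least 2 because k ≠ 0, and the integrand is dominated by a multiple of 1/(1 +
  -- t²).
  set δ := min (‖x‖ ^ 2) 1 / 2 with hδ
  have hδ0 : 0 < δ := by positivity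
  refine (integrable_inv_one_add_sq.const_mul ((c ^ (j + 2) * ‖x‖ ^ j * δ)⁻¹)).mono'
    (hp.continuous_inv_pow _ hx).aestronglyMeasurable (Filter.Eventually.of_forall fun t => ?_)
  have hM : 0 < ‖(x, t)‖ := norm_pos_iff.2 (by simp [hx])
  have hM1 : ‖x‖ ≤ ‖(x, t)‖ := norm_fst_le (x, t)
  have hM2 : |t| ≤ ‖(x, t)‖ := norm_snd_le (x, t)
  have h1 : δ * (1 + t ^ 2) ≤ ‖(x, t)‖ ^ 2 := by
    have a1 : ‖x‖ ^ 2 ≤ ‖(x, t)‖ ^ 2 := by gcongr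
    have a2 : t ^ 2 ≤ ‖(x, t)‖ ^ 2 := by
      rw [← sq_abs]
      gcongr
    have a3 : min (‖x‖ ^ 2) 1 ≤ ‖x‖ ^ 2 := min_le_left _ _
    have a4 : min (‖x‖ ^ 2) 1 * t ^ 2 ≤ 1 * t ^ 2 := by
      gcongr
      exact min_le_right _ _
    rw [hδ]
    linarith
  rw [Real.norm_of_nonneg (by have := hp.nonneg (x, t); positivity), ← mul_inv]
  refine inv_anti₀ (by positivity) ?_
  calc c ^ (j + 2) * ‖x‖ ^ j * δ * (1 + t ^ 2) = c ^ (j + 2) * (‖x‖ ^ j * (δ * (1 + t ^ 2))) := by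
        ring
    _ ≤ c ^ (j + 2) * (‖(x, t)‖ ^ j * ‖(x, t)‖ ^ 2) := by gcongr
    _ = (c * ‖(x, t)‖) ^ (j + 2) := by ring
    _ ≤ p (x, t) ^ (j + 2) := by
      gcongr
      exact hcp _

theorem integral_inv_pow_pos (hp : IsNormLike p) {k : ℕ} (hk : k ≠ 0) {x : X} (hx : x ≠ 0) :
    0 < ∫ t : ℝ, (p (x, t) ^ (k + 1))⁻¹ := by
  have h0 : ∀ t : ℝ, 0 < (p (x, t) ^ (k + 1))⁻¹ := fun t =>
    inv_pos.2 (pow_pos (hp.pos (x, t) (by simp [hx])) _)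
  rw [integral_pos_iff_support_of_nonneg (fun t => (h0 t).le) (hp.integrable_inv_pow hk hx)]
  have : Function.support (fun t : ℝ => (p (x, t) ^ (k + 1))⁻¹) = Set.univ :=
    Set.eq_univ_of_forall fun t => (h0 t).ne'
  simp [this]

/-- Integrating out one real variable, norm-like functions go to norm-like functions. -/
theorem exists_marginal (hp : IsNormLike p) {k : ℕ} (hk : k ≠ 0) :
    ∃ q : X → ℝ, IsNormLike q ∧ ∀ x, x ≠ 0 →
      ∫⁻ t : ℝ, ENNReal.ofReal ((p (x, t) ^ (k + 1))⁻¹) = ENNReal.ofReal ((q x ^ k)⁻¹) := by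
  classical
  -- The value at 0 is imposed separately: there the integrand is a multiple of |t|^(-(k+1)), which
  -- is not integrable.
  have hexists : ∀ x : X, ∃ r : ℝ, (x = 0 → r = 0) ∧
      (x ≠ 0 → 0 < r ∧ ∫ t : ℝ, (p (x, t) ^ (k + 1))⁻¹ = (r ^ k)⁻¹) := by
    intro x
    by_cases hx : x = 0
    · exact ⟨0, fun _ => rfl, fun h => absurd hx h⟩
    · have hI := hp.integral_inv_pow_pos hk hx
      refine ⟨(∫ t : ℝ, (p (x, t) ^ (k + 1))⁻¹)⁻¹ ^ ((k : ℝ)⁻¹), fun h => absurd h hx,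
        fun _ => ⟨by positivity, ?_⟩⟩
      rw [Real.rpow_inv_natCast_pow (by positivity) hk, inv_inv]
  choose q hq0 hq using hexists
  have hint : ∀ x, x ≠ 0 →
      ∫⁻ t : ℝ, ENNReal.ofReal ((p (x, t) ^ (k + 1))⁻¹) = ENNReal.ofReal ((q x ^ k)⁻¹) := by
    intro x hx
    rw [← (hq x hx).2, ofReal_integral_eq_lintegral_ofReal (hp.integrable_inv_pow hk hx)]
    exact Filter.Eventually.of_forall fun t => by have := hp.nonneg (x, t); positivity
  have hnn : ∀ x, 0 ≤ q x := fun x => by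
    by_cases hx : x = 0
    · exact (hq0 x hx).ge
    · exact (hq x hx).1.le
  refine ⟨q, ⟨fun x y => ?_, fun s x => ?_, fun x hx => (hq x hx).1⟩, hint⟩
  · by_cases hx : x = 0
    · rw [hx, zero_add, hq0 0 rfl, zero_add]
    by_cases hy : y = 0
    · rw [hy, add_zero, hq0 0 rfl, add_zero]
    by_cases hxy : x + y = 0
    · rw [hq0 _ hxy]
      exact add_nonneg (hnn x) (hnn y)
    have hc : ∀ z : X, Continuous fun t : ℝ => p (z, t) := fun z =>
      hp.continuous.comp (Continuous.prodMk_right z)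
    have h := le_lintegral_of_add_le (hc x) (hc y) (fun t => hp.pos _ (by simp [hx]))
      (fun t => hp.pos _ (by simp [hy])) (w := fun t => p (x + y, t))
      (fun t => hp.pos _ (by simp [hxy])) (fun a b => hp.add_le (x, a) (y, b)) k
      (hq x hx).1 (hq y hy).1 (hp.integrable_inv_pow hk hx) (hp.integrable_inv_pow hk hy)
      (hq x hx).2 (hq y hy).2
    have pxy := (hq _ hxy).1
    have px := (hq _ hx).1
    have py := (hq _ hy).1
    rw [hint _ hxy, ENNReal.ofReal_le_ofReal_iff (by positivity),
      inv_le_inv₀ (by positivity) (by positivity)] at h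
    exact le_of_pow_le_pow_left₀ hk (by positivity) h
  · by_cases hs : s = 0
    · rw [hs, zero_smul, hq0 0 rfl, abs_zero, zero_mul]
    by_cases hx : x = 0
    · rw [hx, smul_zero, hq0 0 rfl, mul_zero]
    have hsx : s • x ≠ 0 := smul_ne_zero hs hx
    have px := (hq _ hx).1
    have psx := (hq _ hsx).1
    have hs' : 0 < |s| := abs_pos.2 hs
    -- Homogeneity by substituting st for t: the integrand contributes |s|^(-(k+1)) and the Jacobian
    -- |s|^(-1), which leaves |s|^(-k) for the marginal.
    have h1 := Measure.integral_comp_mul_left (fun t : ℝ => (p (s • x, t) ^ (k + 1))⁻¹) s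
    have h2 : ∀ t : ℝ, (p (s • x, s * t) ^ (k + 1))⁻¹ =
        (|s| ^ (k + 1))⁻¹ * (p (x, t) ^ (k + 1))⁻¹ := by
      intro t
      have := hp.smul s (x, t)
      rw [Prod.smul_mk, smul_eq_mul] at this
      rw [this, mul_pow, mul_inv]
    simp_rw [h2] at h1
    rw [integral_const_mul, (hq x hx).2, (hq _ hsx).2, abs_inv, smul_eq_mul] at h1
    have h3 : q (s • x) ^ k = (|s| * q x) ^ k := by
      have h4 : |s| ^ (k + 1) * q x ^ k = |s| * q (s • x) ^ k := by
        rw [← mul_inv, ← mul_inv] at h1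
        exact inv_injective h1
      rw [pow_succ', mul_assoc] at h4
      rw [mul_pow, mul_left_cancel₀ hs'.ne' h4]
    exact (pow_left_inj₀ psx.le (by positivity) hk).1 h3

end

/-- Integrating out several real variables, norm-like functions go to norm-like functions. -/
theorem exists_marginal_pi {k : ℕ} (hk : k ≠ 0) (d : ℕ) {X : Type*} [NormedAddCommGroup X]
    [NormedSpace ℝ X] [FiniteDimensional ℝ X] {p : X × (Fin d → ℝ) → ℝ} (hp : IsNormLike p) :
    ∃ q : X → ℝ, IsNormLike q ∧ ∀ x, x ≠ 0 →
      ∫⁻ e : Fin d → ℝ, ENNReal.ofReal ((p (x, e) ^ (k + d))⁻¹) =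
        ENNReal.ofReal ((q x ^ k)⁻¹) := by
  induction d with
  | zero =>
    refine ⟨fun x => p (x, 0), hp.comp_linearMap (LinearMap.inl ℝ X _) LinearMap.inl_injective,
      fun x _ => ?_⟩
    have h : ∀ e, p (x, e) = p (x, 0) := fun e => by rw [Subsingleton.elim e 0]
    simp_rw [h]
    rw [lintegral_const, volume_pi, Measure.pi_of_empty]
    simp
  | succ d ih =>
    let A : ((X × (Fin d → ℝ)) × ℝ) →ₗ[ℝ] X × (Fin (d + 1) → ℝ) :=
      { toFun := fun y => (y.1.1, Fin.cons y.2 y.1.2)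
        map_add' := fun y z => by
          ext i
          · simp
          · refine Fin.cases ?_ (fun j => ?_) i <;> simp
        map_smul' := fun c y => by
          ext i
          · simp
          · refine Fin.cases ?_ (fun j => ?_) i <;> simp }
    have hA : Function.Injective A := by
      rintro ⟨⟨x, e⟩, t⟩ ⟨⟨x', e'⟩, t'⟩ h
      simp only [A, LinearMap.coe_mk, AddHom.coe_mk, Prod.mk.injEq, Fin.cons_inj] at h
      simp [h]
    -- Integrating out the first coordinate lowers the exponent from k+d+1 to k+d, and the induction
    -- hypothesis removes the other d.
    obtain ⟨p', hp', hpp'⟩ := (hp.comp_linearMap A hA).exists_marginal (k := k + d) (by omega)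
    obtain ⟨q, hq, hqq⟩ := ih hp'
    refine ⟨q, hq, fun x hx => ?_⟩
    rw [← hqq x hx]
    have hcp : Continuous fun y : ℝ × (Fin d → ℝ) => p (x, Fin.cons y.1 y.2) := by
      refine hp.continuous.comp (continuous_const.prodMk (continuous_pi fun i => ?_))
      refine Fin.cases ?_ (fun j => ?_) i
      · simpa using continuous_fst
      · simp only [Fin.cons_succ]
        fun_prop
    have hm : Measurable fun y : ℝ × (Fin d → ℝ) =>
        ENNReal.ofReal ((p (x, Fin.cons y.1 y.2) ^ (k + (d + 1)))⁻¹) :=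
      ((hcp.measurable.pow_const _).inv).ennreal_ofReal
    have h1 := (volume_preserving_piFinSuccAbove (fun _ : Fin (d + 1) => ℝ) 0).symm.lintegral_comp_emb
      (MeasurableEquiv.measurableEmbedding _)
      (fun e => ENNReal.ofReal ((p (x, e) ^ (k + (d + 1)))⁻¹))
    rw [← h1]
    change ∫⁻ y : ℝ × (Fin d → ℝ), ENNReal.ofReal ((p (x, Fin.insertNth 0 y.1 y.2) ^ _)⁻¹) = _
    simp_rw [Fin.insertNth_zero']
    rw [Measure.volume_eq_prod, lintegral_prod_symm' _ hm]
    refine lintegral_congr fun e => ?_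
    exact hpp' (x, e) (by simp [hx])

end IsNormLike

/-! ### Complex norms, star bodies and their Minkowski functionals -/

variable {n : ℕ}

/-- A function with the properties of a norm on the complex vector space `ℂⁿ`. -/
structure IsComplexNorm (N : Cn n → ℝ) : Prop where
  add_le : ∀ x y, N (x + y) ≤ N x + N y
  smul : ∀ (c : ℂ) (x : Cn n), N (c • x) = ‖c‖ * N x
  pos : ∀ x, x ≠ 0 → 0 < N x

theorem IsComplexNorm.isNormLike {N : Cn n → ℝ} (hN : IsComplexNorm N) : IsNormLike N where
  add_le := hN.add_le
  smul t x := by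
    have := hN.smul (t : ℂ) x
    rwa [Complex.coe_smul, Complex.norm_real, Real.norm_eq_abs] at this
  pos := hN.pos

theorem inter_frontier_nonempty_of_isPreconnected {α : Type*} [TopologicalSpace α] {s t : Set α}
    (hs : IsPreconnected s) (h1 : (s ∩ t).Nonempty) (h2 : (s ∩ tᶜ).Nonempty) :
    (s ∩ frontier t).Nonempty := by
  by_contra hne
  have hcov : s ⊆ interior t ∪ (closure t)ᶜ := by
    intro x hx
    by_contra h
    rw [Set.mem_union, not_or, Set.notMem_compl_iff] at h
    exact hne ⟨x, hx, h.2, h.1⟩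
  obtain ⟨x, hx, hxt⟩ := h1
  obtain ⟨y, hy, hyt⟩ := h2
  have hx' : x ∈ interior t := (hcov hx).resolve_right fun h => h (subset_closure hxt)
  have hy' : y ∈ (closure t)ᶜ := (hcov hy).resolve_left fun h => hyt (interior_subset h)
  obtain ⟨z, -, hz1, hz2⟩ := hs _ _ isOpen_interior isClosed_closure.isOpen_compl hcov
    ⟨x, hx, hx'⟩ ⟨y, hy, hy'⟩
  exact hz2 (interior_subset_closure hz1)

/-- Otherwise the line through x would meet the boundary three times: on the negative side, between
0 and t, and beyond 1. The two-point condition thus yields star-shapedness. -/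
theorem IsStarBody.smul_mem_of_mem {L : Set (Cn n)} (hL : IsStarBody L) {x : Cn n} {t : ℝ}
    (ht : 0 ≤ t) (ht1 : t ≤ 1) (hx : x ∈ L) : t • x ∈ L := by
  by_contra htx
  have h0L : (0 : Cn n) ∈ L := interior_subset hL.zero_mem_interior
  have hx0 : x ≠ 0 := by
    rintro rfl
    exact htx (by simpa using h0L)
  have ht0 : 0 < t := by
    refine lt_of_le_of_ne ht ?_
    rintro rfl
    exact htx (by simpa using h0L)
  have htlt : t < 1 := by
    refine lt_of_le_of_ne ht1 ?_
    rintro rfl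
    exact htx (by simpa using hx)
  have hcont : Continuous fun s : ℝ => s • x := by fun_prop
  have cross : ∀ a b : ℝ, a ≤ b → (a • x ∈ L ∧ b • x ∉ L ∨ a • x ∉ L ∧ b • x ∈ L) →
      ∃ s ∈ Set.Icc a b, s • x ∈ frontier L := by
    intro a b hab h
    have hpre : IsPreconnected ((fun s : ℝ => s • x) '' Set.Icc a b) :=
      isPreconnected_Icc.image _ hcont.continuousOn
    have ha : a • x ∈ (fun s : ℝ => s • x) '' Set.Icc a b := ⟨a, Set.left_mem_Icc.2 hab, rfl⟩
    have hb : b • x ∈ (fun s : ℝ => s • x) '' Set.Icc a b := ⟨b, Set.right_mem_Icc.2 hab, rfl⟩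
    obtain ⟨_, ⟨s, hs, rfl⟩, hsf⟩ :
        (((fun s : ℝ => s • x) '' Set.Icc a b) ∩ frontier L).Nonempty := by
      rcases h with ⟨h1, h2⟩ | ⟨h1, h2⟩
      · exact inter_frontier_nonempty_of_isPreconnected hpre ⟨_, ha, h1⟩ ⟨_, hb, h2⟩
      · exact inter_frontier_nonempty_of_isPreconnected hpre ⟨_, hb, h2⟩ ⟨_, ha, h1⟩
    exact ⟨s, hs, hsf⟩
  obtain ⟨R, hR⟩ := hL.isCompact.isBounded.exists_norm_le
  have hxn : 0 < ‖x‖ := norm_pos_iff.2 hx0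
  have far : ∀ s : ℝ, (|R| + 1) / ‖x‖ ≤ |s| → s • x ∉ L := by
    intro s hs hmem
    have h1 := hR _ hmem
    rw [norm_smul, Real.norm_eq_abs] at h1
    rw [div_le_iff₀ hxn] at hs
    have := le_abs_self R
    linarith
  set M := (|R| + 1) / ‖x‖ + 1 with hM
  have hM0 : 0 < (|R| + 1) / ‖x‖ := by positivity
  have hMp : 0 < M := by linarith
  have hM1 : M • x ∉ L := far M (by rw [abs_of_pos hMp]; linarith)
  have hM2 : (-M) • x ∉ L := far (-M) (by rw [abs_neg, abs_of_pos hMp]; linarith)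
  have hM3 : 1 ≤ M := by linarith
  have h0x : (0 : ℝ) • x ∈ L := by rwa [zero_smul]
  have fr0 : (0 : ℝ) • x ∉ frontier L := by
    rw [zero_smul]
    exact fun h => h.2 hL.zero_mem_interior
  have frt : t • x ∉ frontier L := fun h => htx (hL.isCompact.isClosed.frontier_subset h)
  obtain ⟨r, ⟨-, hr2⟩, hr⟩ := cross (-M) 0 (by linarith) (Or.inr ⟨hM2, h0x⟩)
  obtain ⟨s, ⟨hs1, hs2⟩, hs⟩ := cross 0 t ht (Or.inl ⟨h0x, htx⟩)
  obtain ⟨u, ⟨hu1, -⟩, hu⟩ := cross 1 M hM3 (Or.inl ⟨by rwa [one_smul], hM1⟩)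
  have hr0 : r ≠ 0 := by
    rintro rfl
    exact fr0 hr
  have hs0 : s ≠ 0 := by
    rintro rfl
    exact fr0 hs
  have h2 := hL.line_frontier x hx0
  -- `ncard` of an infinite set is 0, so the value 2 also forces finiteness.
  have hfin : {t : ℝ | t • x ∈ frontier L}.Finite := by
    by_contra hinf
    rw [Set.Infinite.ncard hinf] at h2
    omega
  have hsub : ({r, s, u} : Set ℝ) ⊆ {t : ℝ | t • x ∈ frontier L} := by
    rintro y (rfl | rfl | rfl) <;> assumption
  have h3 := Set.ncard_le_ncard hsub hfin
  have hrneg : r < 0 := lt_of_le_of_ne hr2 hr0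
  have hspos : 0 < s := lt_of_le_of_ne hs1 hs0.symm
  rw [h2, Set.ncard_eq_three.2 ⟨r, s, u, by linarith, by linarith, by linarith, rfl⟩] at h3
  omega

/-- Convexity is replaced by star-shapedness: tx belongs to L for t < 1, and closedness gives t = 1.
-/
theorem IsStarBody.gauge_le_one_iff {L : Set (Cn n)} (hL : IsStarBody L) {x : Cn n} :
    gauge L x ≤ 1 ↔ x ∈ L := by
  refine ⟨fun h => ?_, gauge_le_one_of_mem⟩
  have habs : Absorbent ℝ L := absorbent_nhds_zero (mem_interior_iff_mem_nhds.1 hL.zero_mem_interior)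
  have key : ∀ t : ℝ, t ∈ Set.Ico (0 : ℝ) 1 → t • x ∈ L := by
    intro t ht
    have hlt : gauge L (t • x) < 1 := by
      rw [gauge_smul_of_nonneg ht.1, smul_eq_mul]
      exact (mul_le_of_le_one_right ht.1 h).trans_lt ht.2
    obtain ⟨b, hb0, hb1, y, hy, hyx⟩ := exists_lt_of_gauge_lt habs hlt
    rw [← hyx]
    exact hL.smul_mem_of_mem hb0.le hb1.le hy
  have hcl : IsClosed {t : ℝ | t • x ∈ L} :=
    hL.isCompact.isClosed.preimage (by fun_prop : Continuous fun t : ℝ => t • x)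
  have h1 : (1 : ℝ) ∈ closure (Set.Ico (0 : ℝ) 1) := by
    rw [closure_Ico zero_ne_one]
    exact Set.right_mem_Icc.2 zero_le_one
  have h2 : (1 : ℝ) • x ∈ L := closure_minimal (fun t ht => key t ht) hcl h1
  rwa [one_smul] at h2

theorem gauge_complex_smul {K : Set (Cn n)} (hK : IsRotationInvariant K) (c : ℂ) (x : Cn n) :
    gauge K (c • x) = ‖c‖ * gauge K x := by
  have h : c • x = ‖c‖ • (Complex.exp (c.arg * Complex.I) • x) := by
    rw [← Complex.coe_smul, smul_smul, Complex.norm_mul_exp_arg_mul_I]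
  rw [h, gauge_smul_of_nonneg (norm_nonneg c), hK, smul_eq_mul]

theorem IsStarBody.gauge_pos {L : Set (Cn n)} (hL : IsStarBody L) {x : Cn n} (hx : x ≠ 0) :
    0 < gauge L x :=
  (_root_.gauge_pos (absorbent_nhds_zero (mem_interior_iff_mem_nhds.1 hL.zero_mem_interior))
    ((NormedSpace.isVonNBounded_iff ℝ).2 hL.isCompact.isBounded)).2 hx

namespace IsSymmComplexConvexBody

variable {K : Set (Cn n)}

/-- The origin is the midpoint of an interior point and its reflection, which is again interior. -/
theorem mem_nhds_zero (hK : IsSymmComplexConvexBody K) : K ∈ nhds (0 : Cn n) := by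
  obtain ⟨x, hx⟩ := hK.isConvexBody.interior_nonempty
  have hneg : -K = K := by
    ext z
    exact ⟨fun h => by simpa using hK.symm _ h, fun h => hK.symm _ h⟩
  have hx' : -x ∈ interior K := by
    have h := (Homeomorph.neg (Cn n)).preimage_interior K
    change _ = interior (-K) at h
    rw [hneg] at h
    rw [← h]
    simpa using hx
  have h := hK.isConvexBody.convex.interior hx hx' (show (0 : ℝ) ≤ 1 / 2 by norm_num)
    (show (0 : ℝ) ≤ 1 / 2 by norm_num) (by norm_num)
  rw [smul_neg, add_neg_cancel] at h
  exact mem_interior_iff_mem_nhds.1 h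

theorem isComplexNorm_gauge (hK : IsSymmComplexConvexBody K) : IsComplexNorm (gauge K) where
  add_le := gauge_add_le hK.isConvexBody.convex (absorbent_nhds_zero hK.mem_nhds_zero)
  smul := gauge_complex_smul hK.rotation
  pos _ hx := (gauge_pos (absorbent_nhds_zero hK.mem_nhds_zero)
    ((NormedSpace.isVonNBounded_iff ℝ).2 hK.isConvexBody.isCompact.isBounded)).2 hx

theorem isSymmComplexStarBody (hK : IsSymmComplexConvexBody K) : IsSymmComplexStarBody K where
  symm := hK.symm
  rotation := hK.rotation
  isStarBody :=
    { isCompact := hK.isConvexBody.isCompact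
      zero_mem_interior := mem_interior_iff_mem_nhds.2 hK.mem_nhds_zero
      continuous_gauge := continuous_gauge hK.isConvexBody.convex hK.mem_nhds_zero
      line_frontier := by
        intro x hx
        have hN := hK.isComplexNorm_gauge.isNormLike
        have hpos := hN.pos x hx
        have : {t : ℝ | t • x ∈ frontier K} = {(gauge K x)⁻¹, -(gauge K x)⁻¹} := by
          ext t
          rw [Set.mem_ofPred_eq, ← gauge_eq_one_iff_mem_frontier hK.isConvexBody.convex
            hK.mem_nhds_zero, hN.smul, mul_eq_one_iff_eq_inv₀ hpos.ne', abs_eq (by positivity)]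
          rfl
        rw [this, Set.ncard_pair]
        have : 0 < (gauge K x)⁻¹ := by positivity
        linarith }

end IsSymmComplexConvexBody

namespace IsComplexNorm

variable {N : Cn n → ℝ}

theorem gauge_unitBall (hN : IsComplexNorm N) : gauge {x | N x ≤ 1} = N := by
  have hN' := hN.isNormLike
  ext x
  refine le_antisymm ?_ ?_
  · refine le_of_forall_pos_le_add fun ε hε => ?_
    have h0 : 0 < N x + ε := add_pos_of_nonneg_of_pos (hN'.nonneg x) hε
    refine gauge_le_of_mem h0.le ?_
    rw [Set.mem_smul_set_iff_inv_smul_mem₀ h0.ne', Set.mem_ofPred_eq, hN'.smul,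
      abs_of_pos (inv_pos.2 h0), inv_mul_le_iff₀ h0]
    linarith
  · by_cases hx : x = 0
    · rw [hx, gauge_zero, hN'.map_zero]
    have hne : {r : ℝ | r ∈ Set.Ioi (0 : ℝ) ∧ x ∈ r • {x | N x ≤ 1}}.Nonempty := by
      refine ⟨N x, hN.pos x hx, ?_⟩
      rw [Set.mem_smul_set_iff_inv_smul_mem₀ (hN.pos x hx).ne', Set.mem_ofPred_eq, hN'.smul,
        abs_of_pos (inv_pos.2 (hN.pos x hx)), inv_mul_cancel₀ (hN.pos x hx).ne']
    refine le_csInf hne ?_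
    rintro r ⟨hr, y, hy, rfl⟩
    have hr' : 0 < r := hr
    rw [hN'.smul, abs_of_pos hr']
    exact mul_le_of_le_one_right hr'.le hy

theorem isSymmComplexConvexBody (hN : IsComplexNorm N) :
    IsSymmComplexConvexBody {x | N x ≤ 1} where
  symm z hz := by
    have := hN.isNormLike.smul (-1) z
    rw [neg_smul, one_smul, abs_neg, abs_one, one_mul] at this
    simpa [this] using hz
  rotation θ z := by
    rw [hN.gauge_unitBall, hN.smul, Complex.norm_exp_ofReal_mul_I, one_mul]
  isConvexBody :=
    { convex := by simpa using hN.isNormLike.convexOn.convex_le 1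
      isCompact := by
        obtain ⟨c, hc, hcN⟩ := hN.isNormLike.exists_mul_norm_le
        refine (isCompact_closedBall (0 : Cn n) c⁻¹).of_isClosed_subset
          (isClosed_le hN.isNormLike.continuous continuous_const) fun x hx => ?_
        rw [mem_closedBall_zero_iff, ← one_div, le_div_iff₀ hc, mul_comm]
        exact (hcN x).trans hx
      interior_nonempty := by
        refine ⟨0, mem_interior.2 ⟨{x | N x < 1}, fun x (hx : N x < 1) => hx.le,
          isOpen_lt hN.isNormLike.continuous continuous_const, ?_⟩⟩
        simp [hN.isNormLike.map_zero] }

end IsComplexNorm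

/-! ### Complex hyperplanes and sections by complex lines -/

theorem mem_hyperplane_iff {ξ z : Cn n} : z ∈ hyperplane ξ ↔ inner ℂ ξ z = 0 := by
  rw [PiLp.inner_apply]
  rfl

theorem hyperplane_eq (ξ : Cn n) : hyperplane ξ = (ℂ ∙ ξ)ᗮ := by
  ext z
  rw [mem_hyperplane_iff, Submodule.mem_orthogonal_singleton_iff_inner_right]

theorem hyperplane_orthogonal (ξ : Cn n) : (hyperplane ξ)ᗮ = ℂ ∙ ξ := by
  rw [hyperplane_eq, Submodule.orthogonal_orthogonal]

/-- The isometry of the complex plane with the complex line spanned by a unit vector. -/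
def lineIsometry {ξ : Cn n} (hξ : ‖ξ‖ = 1) :
    ℂ →ₗᵢ[ℝ] (hyperplane ξ)ᗮ.restrictScalars ℝ where
  toFun z := ⟨z • ξ, by
    rw [Submodule.restrictScalars_mem, hyperplane_orthogonal]
    exact Submodule.smul_mem _ _ (Submodule.mem_span_singleton_self ξ)⟩
  map_add' z w := by
    ext1
    simp [add_smul]
  map_smul' t z := by
    ext1
    exact smul_assoc t z ξ
  norm_map' z := by
    change ‖z • ξ‖ = ‖z‖
    rw [norm_smul, hξ, mul_one]

theorem lineIsometry_surjective {ξ : Cn n} (hξ : ‖ξ‖ = 1) :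
    Function.Surjective (lineIsometry hξ) := by
  rintro ⟨w, hw⟩
  rw [Submodule.restrictScalars_mem, hyperplane_orthogonal, Submodule.mem_span_singleton] at hw
  obtain ⟨z, rfl⟩ := hw
  exact ⟨z, rfl⟩

/-- In the coordinate z ↦ zξ the section is a round disc of radius 1/‖ξ‖_L, because ‖zξ‖_L = |z|
‖ξ‖_L. -/
theorem IsSymmComplexStarBody.sectionVolume_line {L : Set (Cn n)} (hL : IsSymmComplexStarBody L)
    {ξ : Cn n} (hξ : ‖ξ‖ = 1) :
    sectionVolume L (hyperplane ξ)ᗮ = ENNReal.ofReal (Real.pi / gauge L ξ ^ 2) := by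
  have hξ0 : ξ ≠ 0 := by
    rintro rfl
    simp at hξ
  have hpos := hL.isStarBody.gauge_pos hξ0
  have hmp := LinearIsometryEquiv.measurePreserving (E := ℂ)
    (F := (hyperplane ξ)ᗮ.restrictScalars ℝ)
    (LinearIsometryEquiv.ofSurjective (lineIsometry hξ) (lineIsometry_surjective hξ))
  have hmeas : MeasurableSet
      {z : (hyperplane ξ)ᗮ.restrictScalars ℝ | (z : Cn n) ∈ L} :=
    (hL.isStarBody.isCompact.isClosed.preimage continuous_subtype_val).measurableSet
  rw [sectionVolume, ← hmp.measure_preimage hmeas.nullMeasurableSet]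
  have hset : (LinearIsometryEquiv.ofSurjective (lineIsometry hξ) (lineIsometry_surjective hξ)) ⁻¹'
      {z : (hyperplane ξ)ᗮ.restrictScalars ℝ | (z : Cn n) ∈ L} =
      Metric.closedBall (0 : ℂ) (gauge L ξ)⁻¹ := by
    ext z
    change z • ξ ∈ L ↔ _
    rw [← hL.isStarBody.gauge_le_one_iff, gauge_complex_smul hL.rotation, mem_closedBall_zero_iff,
      ← one_div, le_div_iff₀ hpos]
  rw [hset, Complex.volume_closedBall, div_eq_mul_inv, ENNReal.ofReal_mul Real.pi_pos.le, mul_comm,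
    ← inv_pow, ENNReal.ofReal_pow (by positivity), ← NNReal.coe_real_pi, ENNReal.ofReal_coe_nnreal]

/-! ### Hyperplane sections as integrals of a negative power of the norm -/

/-- The integral of `‖z‖ ^ d` over the unit disc. -/
def discMoment (d : ℕ) : ENNReal :=
  ∫⁻ z in Metric.closedBall (0 : ℂ) 1, ENNReal.ofReal (‖z‖ ^ d)

theorem discMoment_ne_top (d : ℕ) : discMoment d ≠ ⊤ := by
  refine ne_top_of_le_ne_top (measure_closedBall_lt_top (μ := volume) (x := (0 : ℂ)) (r := 1)).ne ?_
  rw [discMoment, ← setLIntegral_one]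
  refine setLIntegral_mono measurable_const fun z hz => ?_
  rw [← ENNReal.ofReal_one]
  exact ENNReal.ofReal_le_ofReal (pow_le_one₀ (norm_nonneg z) (mem_closedBall_zero_iff.1 hz))

theorem discMoment_ne_zero (d : ℕ) : discMoment d ≠ 0 := by
  intro h
  rw [discMoment, lintegral_eq_zero_iff (by fun_prop), Filter.EventuallyEq,
    ae_restrict_iff' measurableSet_closedBall] at h
  have h0 : ∀ᵐ z : ℂ, z ∉ Metric.closedBall (0 : ℂ) 1 := by
    filter_upwards [h, Measure.ae_ne volume (0 : ℂ)] with z hz hz0 hmem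
    have := hz hmem
    simp only [Pi.zero_apply, ENNReal.ofReal_eq_zero] at this
    exact absurd this (not_le.2 (pow_pos (norm_pos_iff.2 hz0) d))
  have h1 : volume (Metric.closedBall (0 : ℂ) 1) = 0 := by
    rw [measure_eq_zero_iff_ae_notMem]
    exact h0
  exact (Metric.measure_closedBall_pos volume (0 : ℂ) one_pos).ne' h1

theorem lintegral_closedBall_norm_pow (d : ℕ) {R : ℝ} (hR : 0 < R) :
    ∫⁻ z in Metric.closedBall (0 : ℂ) R, ENNReal.ofReal (‖z‖ ^ d) =
      ENNReal.ofReal (R ^ (d + 2)) * discMoment d := by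
  have h := lintegral_map (μ := (volume : Measure ℂ)) (g := fun z : ℂ => R • z)
    (f := (Metric.closedBall (0 : ℂ) R).indicator fun z => ENNReal.ofReal (‖z‖ ^ d))
    (Measurable.indicator (by fun_prop) measurableSet_closedBall) (by fun_prop)
  rw [Measure.map_addHaar_smul _ hR.ne', lintegral_smul_measure,
    lintegral_indicator measurableSet_closedBall, Complex.finrank_real_complex] at h
  have h2 : ∀ z : ℂ, (Metric.closedBall (0 : ℂ) R).indicator (fun z => ENNReal.ofReal (‖z‖ ^ d))
      (R • z) = ENNReal.ofReal (R ^ d) *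
        (Metric.closedBall (0 : ℂ) 1).indicator (fun z => ENNReal.ofReal (‖z‖ ^ d)) z := by
    intro z
    have hn : ‖R • z‖ = R * ‖z‖ := by rw [norm_smul, Real.norm_of_nonneg hR.le]
    by_cases hz : z ∈ Metric.closedBall (0 : ℂ) 1
    · have hz' : R • z ∈ Metric.closedBall (0 : ℂ) R := by
        rw [mem_closedBall_zero_iff] at hz ⊢
        rw [hn]
        exact mul_le_of_le_one_right hR.le hz
      rw [Set.indicator_of_mem hz, Set.indicator_of_mem hz', hn, mul_pow,
        ENNReal.ofReal_mul (by positivity)]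
    · have hz' : R • z ∉ Metric.closedBall (0 : ℂ) R := by
        rw [mem_closedBall_zero_iff] at hz ⊢
        rw [hn]
        exact fun h => hz (le_of_mul_le_mul_left (by linarith) hR)
      rw [Set.indicator_of_notMem hz, Set.indicator_of_notMem hz', mul_zero]
  simp_rw [h2] at h
  rw [lintegral_const_mul' _ _ ENNReal.ofReal_ne_top, lintegral_indicator measurableSet_closedBall,
    abs_of_pos (by positivity), smul_eq_mul] at h
  have h3 : ENNReal.ofReal (R ^ 2) * (ENNReal.ofReal (R ^ 2)⁻¹ *
      ∫⁻ z in Metric.closedBall (0 : ℂ) R, ENNReal.ofReal (‖z‖ ^ d)) =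
      ENNReal.ofReal (R ^ 2) * (ENNReal.ofReal (R ^ d) * discMoment d) := by
    rw [h]
    rfl
  rw [← mul_assoc, ← mul_assoc, ← ENNReal.ofReal_mul (by positivity),
    ← ENNReal.ofReal_mul (by positivity), mul_inv_cancel₀ (by positivity), ENNReal.ofReal_one,
    one_mul] at h3
  rw [h3, pow_add, mul_comm (R ^ 2)]

/-- Multiplication by a unimodular number as an isometry of a complex subspace. -/
def rotation (E : Submodule ℂ (Cn n)) {c : ℂ} (hc : ‖c‖ = 1) :
    E.restrictScalars ℝ →ₗᵢ[ℝ] E.restrictScalars ℝ where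
  toFun e := ⟨c • (e : Cn n), E.smul_mem c e.2⟩
  map_add' e f := Subtype.ext (smul_add c (e : Cn n) f)
  map_smul' t e := Subtype.ext (smul_comm c t (e : Cn n))
  norm_map' e := by
    change ‖c • (e : Cn n)‖ = ‖(e : Cn n)‖
    rw [norm_smul, hc, one_mul]

theorem rotation_surjective (E : Submodule ℂ (Cn n)) {c : ℂ} (hc : ‖c‖ = 1) :
    Function.Surjective (rotation E hc) := by
  intro e
  have hc0 : c ≠ 0 := by
    rintro rfl
    simp at hc
  exact ⟨⟨c⁻¹ • (e : Cn n), E.smul_mem _ e.2⟩, Subtype.ext (smul_inv_smul₀ hc0 (e : Cn n))⟩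

/-- Multiplication by z/|z| preserves N and acts on E isometrically, so z may be replaced by |z|.
Rescaling e by |z| then pulls |z| out of N and costs |z|^d. -/
theorem volume_fiber {N : Cn n → ℝ} (hN : IsComplexNorm N) (E : Submodule ℂ (Cn n)) (η : Cn n)
    {z : ℂ} (hz : z ≠ 0) :
    volume {e : E.restrictScalars ℝ | N (z • η + e) ≤ 1} =
      ENNReal.ofReal (‖z‖ ^ Module.finrank ℝ (E.restrictScalars ℝ)) *
        volume {e : E.restrictScalars ℝ | ‖z‖ * N (η + e) ≤ 1} := by
  have hr : 0 < ‖z‖ := norm_pos_iff.2 hz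
  have hcN := hN.isNormLike.continuous
  have hc : ‖z / ‖z‖‖ = 1 := by
    rw [norm_div, Complex.norm_real, norm_norm, div_self hr.ne']
  have hmp := LinearIsometryEquiv.measurePreserving (E := E.restrictScalars ℝ)
    (F := E.restrictScalars ℝ)
    (LinearIsometryEquiv.ofSurjective (rotation E hc) (rotation_surjective E hc))
  have hmeas : MeasurableSet {e : E.restrictScalars ℝ | N (z • η + e) ≤ 1} :=
    (isClosed_le (by fun_prop) continuous_const).measurableSet
  rw [← hmp.measure_preimage hmeas.nullMeasurableSet]
  have hset : (LinearIsometryEquiv.ofSurjective (rotation E hc) (rotation_surjective E hc)) ⁻¹'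
      {e : E.restrictScalars ℝ | N (z • η + e) ≤ 1} =
      {e : E.restrictScalars ℝ | N (‖z‖ • η + e) ≤ 1} := by
    ext e
    change N (z • η + (z / ‖z‖) • (e : Cn n)) ≤ 1 ↔ N (‖z‖ • η + e) ≤ 1
    have : z • η + (z / ‖z‖) • (e : Cn n) = (z / ‖z‖) • (‖z‖ • η + (e : Cn n)) := by
      rw [smul_add, ← Complex.coe_smul, smul_smul, div_mul_cancel₀]
      exact_mod_cast hr.ne'
    rw [this, hN.smul, hc, one_mul]
  rw [hset]
  have h := Measure.addHaar_preimage_smul (E := E.restrictScalars ℝ) MeasureSpace.volume hr.ne'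
    {e : E.restrictScalars ℝ | N (‖z‖ • η + e) ≤ 1}
  have hset2 : (fun e : E.restrictScalars ℝ => ‖z‖ • e) ⁻¹'
      {e : E.restrictScalars ℝ | N (‖z‖ • η + e) ≤ 1} =
      {e : E.restrictScalars ℝ | ‖z‖ * N (η + e) ≤ 1} := by
    ext e
    change N (‖z‖ • η + ‖z‖ • (e : Cn n)) ≤ 1 ↔ ‖z‖ * N (η + e) ≤ 1
    rw [← smul_add, hN.isNormLike.smul, abs_norm]
  rw [hset2, abs_of_pos (by positivity)] at h
  rw [h, ← mul_assoc, ← ENNReal.ofReal_mul (by positivity), mul_inv_cancel₀ (by positivity),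
    ENNReal.ofReal_one, one_mul]

/-- After exchanging the integrals, z ranges for fixed e over the disc of radius 1/N(η + e). The
integral of |z|^d there scales as the radius to the power d+2. -/
theorem lintegral_volume_fiber {N : Cn n → ℝ} (hN : IsComplexNorm N) (E : Submodule ℂ (Cn n))
    {η : Cn n} (hη : η ∉ E) :
    ∫⁻ z : ℂ, volume {e : E.restrictScalars ℝ | N (z • η + e) ≤ 1} =
      discMoment (Module.finrank ℝ (E.restrictScalars ℝ)) * ∫⁻ e : E.restrictScalars ℝ,
        ENNReal.ofReal ((N (η + e) ^ (2 + Module.finrank ℝ (E.restrictScalars ℝ)))⁻¹) := by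
  set d := Module.finrank ℝ (E.restrictScalars ℝ) with hd
  have hcN := hN.isNormLike.continuous
  have hpos : ∀ e : E.restrictScalars ℝ, 0 < N (η + e) := by
    intro e
    refine hN.pos _ fun h => hη ?_
    rw [eq_neg_of_add_eq_zero_left h]
    exact E.neg_mem e.2
  let S : Set (ℂ × E.restrictScalars ℝ) := {y | ‖y.1‖ * N (η + y.2) ≤ 1}
  have hS : MeasurableSet S := (isClosed_le (by fun_prop) continuous_const).measurableSet
  let φ : ℂ × E.restrictScalars ℝ → ENNReal := S.indicator fun y => ENNReal.ofReal (‖y.1‖ ^ d)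
  have hφ : Measurable φ := Measurable.indicator (by fun_prop) hS
  calc ∫⁻ z : ℂ, volume {e : E.restrictScalars ℝ | N (z • η + e) ≤ 1}
      = ∫⁻ z : ℂ, ∫⁻ e : E.restrictScalars ℝ, φ (z, e) := by
        refine lintegral_congr_ae ?_
        filter_upwards [Measure.ae_ne volume (0 : ℂ)] with z hz
        rw [volume_fiber hN E η hz, ← hd]
        have hm : MeasurableSet {e : E.restrictScalars ℝ | ‖z‖ * N (η + e) ≤ 1} :=
          (isClosed_le (by fun_prop) continuous_const).measurableSet
        rw [← setLIntegral_const, ← lintegral_indicator hm]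
        rfl
    _ = ∫⁻ e : E.restrictScalars ℝ, ∫⁻ z : ℂ, φ (z, e) := lintegral_lintegral_swap hφ.aemeasurable
    _ = ∫⁻ e : E.restrictScalars ℝ, discMoment d * ENNReal.ofReal ((N (η + e) ^ (2 + d))⁻¹) := by
        refine lintegral_congr fun e => ?_
        have h := lintegral_closedBall_norm_pow d (inv_pos.2 (hpos e))
        rw [← lintegral_indicator measurableSet_closedBall, inv_pow, add_comm d, mul_comm] at h
        rw [← h]
        refine lintegral_congr fun z => ?_
        have hiff : (z, e) ∈ S ↔ z ∈ Metric.closedBall (0 : ℂ) (N (η + e))⁻¹ := by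
          rw [mem_closedBall_zero_iff, ← one_div, le_div_iff₀ (hpos e)]
          rfl
        by_cases hz : (z, e) ∈ S
        · rw [Set.indicator_of_mem (hiff.1 hz)]
          exact Set.indicator_of_mem hz _
        · rw [Set.indicator_of_notMem (fun h => hz (hiff.2 h))]
          exact Set.indicator_of_notMem hz _
    _ = _ := lintegral_const_mul' _ _ (discMoment_ne_top d)

/-- The orthogonal splitting of a complex subspace `H` into a complex line and its complement. -/
def splitIsometry {E H : Submodule ℂ (Cn n)} {η : Cn n} (hη : ‖η‖ = 1)
    (hE : ∀ e ∈ E, inner ℂ η e = 0) (hηH : η ∈ H) (hEH : E ≤ H) :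
    WithLp 2 (ℂ × E.restrictScalars ℝ) →ₗᵢ[ℝ] H.restrictScalars ℝ where
  toFun y := ⟨y.fst • η + y.snd, H.add_mem (H.smul_mem _ hηH) (hEH y.snd.2)⟩
  map_add' y w := Subtype.ext <| by
    change (y.fst + w.fst) • η + ((y.snd : Cn n) + w.snd) =
      (y.fst • η + y.snd) + (w.fst • η + w.snd)
    rw [add_smul]
    abel
  map_smul' t y := Subtype.ext <| by
    change (t • y.fst) • η + t • (y.snd : Cn n) = t • (y.fst • η + (y.snd : Cn n))
    rw [smul_add, smul_assoc]
  norm_map' y := by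
    change ‖y.fst • η + (y.snd : Cn n)‖ = ‖y‖
    have h1 := norm_add_sq_eq_norm_sq_add_norm_sq_of_inner_eq_zero (𝕜 := ℂ) (y.fst • η)
      (y.snd : Cn n) (by rw [inner_smul_left, hE _ y.snd.2, mul_zero])
    have h2 := WithLp.prod_norm_sq_eq_of_L2 y
    rw [norm_smul, hη, mul_one] at h1
    have h3 : ‖y.snd‖ = ‖(y.snd : Cn n)‖ := rfl
    rw [← abs_norm (y.fst • η + (y.snd : Cn n)), ← abs_norm y, ← sq_eq_sq_iff_abs_eq_abs, h2, h3]
    linarith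

/-- H is the orthogonal sum of ℂη and E, so its volume is the product volume and Fubini over z
applies. -/
theorem volume_section {N : Cn n → ℝ} (hN : IsComplexNorm N) {E H : Submodule ℂ (Cn n)}
    {η : Cn n} (hη : ‖η‖ = 1) (hE : ∀ e ∈ E, inner ℂ η e = 0) (hηH : η ∈ H) (hEH : E ≤ H)
    (hH : ∀ w ∈ H, inner ℂ η w = 0 → w ∈ E) :
    sectionVolume {x | N x ≤ 1} H =
      discMoment (Module.finrank ℝ (E.restrictScalars ℝ)) * ∫⁻ e : E.restrictScalars ℝ,
        ENNReal.ofReal ((N (η + e) ^ (2 + Module.finrank ℝ (E.restrictScalars ℝ)))⁻¹) := by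
  have hcN := hN.isNormLike.continuous
  have hηη : inner ℂ η η = 1 := by rw [inner_self_eq_norm_sq_to_K, hη]; norm_num
  have hsurj : Function.Surjective (splitIsometry hη hE hηH hEH) := by
    rintro ⟨w, hw⟩
    have hw' : w - inner ℂ η w • η ∈ E := by
      refine hH _ (H.sub_mem hw (H.smul_mem _ hηH)) ?_
      rw [inner_sub_right, inner_smul_right, hηη, mul_one, sub_self]
    refine ⟨WithLp.toLp 2 (inner ℂ η w, ⟨w - inner ℂ η w • η, hw'⟩), Subtype.ext ?_⟩
    exact add_sub_cancel _ _
  have hηE : η ∉ E := fun h => one_ne_zero (hηη.symm.trans (hE _ h))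
  have hmp := (LinearIsometryEquiv.measurePreserving (E := WithLp 2 (ℂ × E.restrictScalars ℝ))
    (F := H.restrictScalars ℝ)
    (LinearIsometryEquiv.ofSurjective (splitIsometry hη hE hηH hEH) hsurj)).comp
    (WithLp.volume_preserving_toLp ℂ (E.restrictScalars ℝ))
  have hmeas : MeasurableSet {w : H.restrictScalars ℝ | (w : Cn n) ∈ {x | N x ≤ 1}} :=
    (isClosed_le (f := fun w : H.restrictScalars ℝ => N w) (by fun_prop)
      continuous_const).measurableSet
  have hm2 : MeasurableSet {y : ℂ × E.restrictScalars ℝ | N (y.1 • η + y.2) ≤ 1} :=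
    (isClosed_le (by fun_prop) continuous_const).measurableSet
  rw [sectionVolume, ← hmp.measure_preimage hmeas.nullMeasurableSet,
    ← lintegral_volume_fiber hN E hηE]
  change volume {y : ℂ × E.restrictScalars ℝ | N (y.1 • η + y.2) ≤ 1} = _
  rw [Measure.volume_eq_prod, Measure.prod_apply hm2]
  rfl

/-! ### Restriction to a complex plane -/

/-- The orthogonal complement of the complex plane spanned by two vectors. -/
def planeComplement (a b : Cn n) : Submodule ℂ (Cn n) := (Submodule.span ℂ {a, b})ᗮ

theorem mem_planeComplement {a b e : Cn n} :
    e ∈ planeComplement a b ↔ inner ℂ a e = 0 ∧ inner ℂ b e = 0 := by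
  rw [planeComplement, Submodule.mem_orthogonal]
  refine ⟨fun h => ⟨h a (Submodule.subset_span (by simp)), h b (Submodule.subset_span (by simp))⟩,
    fun h u hu => ?_⟩
  obtain ⟨x, y, rfl⟩ := Submodule.mem_span_pair.1 hu
  rw [inner_add_left, inner_smul_left, inner_smul_left, h.1, h.2, mul_zero, mul_zero, add_zero]

theorem inner_self_eq_one {a : Cn n} (ha : ‖a‖ = 1) : inner ℂ a a = 1 := by
  rw [inner_self_eq_norm_sq_to_K, ha]
  norm_num

theorem coeff_eq_zero {a b e : Cn n} (ha : ‖a‖ = 1) (hb : ‖b‖ = 1) (hab : inner ℂ a b = 0)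
    (he : e ∈ planeComplement a b) {x y : ℂ} (h : x • a + y • b + e = 0) : x = 0 ∧ y = 0 := by
  have hba : inner ℂ b a = 0 := inner_eq_zero_symm.1 hab
  obtain ⟨h1, h2⟩ := mem_planeComplement.1 he
  constructor
  · have := congrArg (inner ℂ a) h
    rwa [inner_add_right, inner_add_right, inner_smul_right, inner_smul_right,
      inner_self_eq_one ha, hab, h1, inner_zero_right, mul_one, mul_zero, add_zero,
      add_zero] at this
  · have := congrArg (inner ℂ b) h
    rwa [inner_add_right, inner_add_right, inner_smul_right, inner_smul_right,
      inner_self_eq_one hb, hba, h2, inner_zero_right, mul_one, mul_zero, zero_add,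
      add_zero] at this

theorem exists_plane_marginal {N : Cn n → ℝ} (hN : IsComplexNorm N) {a b : Cn n} (ha : ‖a‖ = 1)
    (hb : ‖b‖ = 1) (hab : inner ℂ a b = 0) :
    ∃ q : ℂ × ℂ → ℝ, IsNormLike q ∧ ∀ u, u ≠ 0 →
      ∫⁻ e : (planeComplement a b).restrictScalars ℝ, ENNReal.ofReal ((N (u.1 • a + u.2 • b + e) ^
        (2 + Module.finrank ℝ ((planeComplement a b).restrictScalars ℝ)))⁻¹) =
        ENNReal.ofReal ((q u ^ 2)⁻¹) := by
  set E := (planeComplement a b).restrictScalars ℝ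
  set d := Module.finrank ℝ E
  let ι : (Fin d → ℝ) → E := fun v => (stdOrthonormalBasis ℝ E).repr.symm (WithLp.toLp 2 v)
  have hι : MeasurePreserving ι MeasureSpace.volume MeasureSpace.volume :=
    (LinearIsometryEquiv.measurePreserving (E := EuclideanSpace ℝ (Fin d)) (F := E)
      (stdOrthonormalBasis ℝ E).repr.symm).comp (PiLp.volume_preserving_toLp _)
  let A : ((ℂ × ℂ) × (Fin d → ℝ)) →ₗ[ℝ] Cn n :=
    { toFun := fun y => y.1.1 • a + y.1.2 • b + (ι y.2 : Cn n)
      map_add' := fun y w => by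
        have : ι (y.2 + w.2) = ι y.2 + ι w.2 := by simp [ι]
        simp only [Prod.fst_add, Prod.snd_add, this, Submodule.coe_add, add_smul]
        abel
      map_smul' := fun t y => by
        have : ι (t • y.2) = t • ι y.2 := by simp [ι]
        simp only [Prod.smul_fst, Prod.smul_snd, this, Submodule.coe_smul, smul_add, smul_assoc,
          RingHom.id_apply] }
  have hA : Function.Injective A := by
    rw [← LinearMap.ker_eq_bot, LinearMap.ker_eq_bot']
    rintro ⟨⟨x, y⟩, v⟩ h
    change x • a + y • b + (ι v : Cn n) = 0 at h
    obtain ⟨hx, hy⟩ := coeff_eq_zero ha hb hab (ι v).2 h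
    have hv : v = 0 := by
      rw [hx, hy, zero_smul, zero_smul, zero_add, zero_add, Submodule.coe_eq_zero] at h
      simpa [ι] using h
    rw [hx, hy, hv]
    rfl
  -- In an orthonormal real basis of E, N becomes a norm on ℂ² × ℝ^d. The exponent left after d
  -- integrations is 2, the real dimension of a complex line.
  obtain ⟨q, hq, hqq⟩ := (hN.isNormLike.comp_linearMap A hA).exists_marginal_pi two_ne_zero d
  refine ⟨q, hq, fun u hu => ?_⟩
  rw [← hqq u hu]
  have hcN := hN.isNormLike.continuous
  have hm : Measurable fun e : E => ENNReal.ofReal ((N (u.1 • a + u.2 • b + e) ^ (2 + d))⁻¹) := by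
    have : Continuous fun e : E => N (u.1 • a + u.2 • b + e) := by fun_prop
    exact ((this.measurable.pow_const _).inv).ennreal_ofReal
  exact (hι.lintegral_comp hm).symm

theorem exists_plane_sectionVolume {N : Cn n → ℝ} (hN : IsComplexNorm N) {a b : Cn n}
    (ha : ‖a‖ = 1) (hb : ‖b‖ = 1) (hab : inner ℂ a b = 0) :
    ∃ (q : ℂ × ℂ → ℝ) (C : ℝ), 0 < C ∧ IsNormLike q ∧ ∀ x y : ℂ, ‖x • a + y • b‖ = 1 →
      sectionVolume {z | N z ≤ 1} (hyperplane (x • a + y • b)) =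
        ENNReal.ofReal (C / q (x, y) ^ 2) := by
  obtain ⟨q, hq, hqq⟩ := exists_plane_marginal hN ha hb hab
  have hba : inner ℂ b a = 0 := inner_eq_zero_symm.1 hab
  set d := Module.finrank ℝ ((planeComplement a b).restrictScalars ℝ)
  have haa := inner_self_eq_one ha
  have hbb := inner_self_eq_one hb
  -- J sends the coordinates of ξ to those of a vector η of equal length, orthogonal to ξ in the
  -- plane. It is conjugate-linear, so only real linearity is available; that suffices for
  -- transporting the norm q.
  let J : ℂ × ℂ →ₗ[ℝ] ℂ × ℂ :=
    { toFun := fun u => (-(starRingEnd ℂ) u.2, (starRingEnd ℂ) u.1)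
      map_add' := fun u v => by
        ext1 <;> simp [add_comm]
      map_smul' := fun t u => by
        ext1 <;> simp }
  have hJ : Function.Injective J := by
    rintro ⟨x, y⟩ ⟨x', y'⟩ h
    have h1 : (starRingEnd ℂ) x = (starRingEnd ℂ) x' := congrArg Prod.snd h
    have h2 : -(starRingEnd ℂ) y = -(starRingEnd ℂ) y' := congrArg Prod.fst h
    rw [(starRingEnd ℂ).injective h1, (starRingEnd ℂ).injective (neg_injective h2)]
  refine ⟨fun u => q (J u), (discMoment d).toReal,
    ENNReal.toReal_pos (discMoment_ne_zero d) (discMoment_ne_top d), hq.comp_linearMap J hJ,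
    fun x y hxy => ?_⟩
  set ξ := x • a + y • b with hξ
  set η := (-(starRingEnd ℂ) y) • a + (starRingEnd ℂ) x • b with hη
  have hsum : x * (starRingEnd ℂ) x + y * (starRingEnd ℂ) y = 1 := by
    have := inner_self_eq_one hxy
    simp only [hξ, inner_add_left, inner_add_right, inner_smul_left, inner_smul_right, haa, hbb,
      hab, hba] at this
    linear_combination this
  have hηη : inner ℂ η η = 1 := by
    simp only [hη, inner_add_left, inner_add_right, inner_smul_left, inner_smul_right, haa, hbb,
      hab, hba, map_neg, Complex.conj_conj]
    linear_combination hsum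
  have hη1 : ‖η‖ = 1 := by
    have h := inner_self_eq_norm_sq_to_K (𝕜 := ℂ) η
    rw [hηη] at h
    have h' : ‖η‖ ^ 2 = 1 := Complex.ofReal_injective (by simpa using h.symm)
    exact (pow_eq_one_iff_of_nonneg (norm_nonneg η) two_ne_zero).1 h'
  have hξη : inner ℂ ξ η = 0 := by
    simp only [hξ, hη, inner_add_left, inner_add_right, inner_smul_left, inner_smul_right, haa, hbb,
      hab, hba]
    ring
  have hE : ∀ x y : ℂ, ∀ e ∈ planeComplement a b, inner ℂ (x • a + y • b) e = 0 := by
    intro x y e he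
    obtain ⟨h1, h2⟩ := mem_planeComplement.1 he
    rw [inner_add_left, inner_smul_left, inner_smul_left, h1, h2, mul_zero, mul_zero, add_zero]
  have hJ0 : J (x, y) ≠ 0 := by
    intro h
    have h0 : (x, y) = (0 : ℂ × ℂ) := hJ (by rw [h, map_zero])
    have hx : x = 0 := congrArg Prod.fst h0
    have hy : y = 0 := congrArg Prod.snd h0
    simp [hx, hy] at hsum
  have hH : ∀ w ∈ hyperplane ξ, inner ℂ η w = 0 → w ∈ planeComplement a b := by
    intro w hw hηw
    rw [mem_hyperplane_iff] at hw
    -- Inverting the unitary change of basis: a vector orthogonal to ξ and η is orthogonal to a and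
    -- b.
    have h1 : a = (starRingEnd ℂ) x • ξ - y • η := by
      have e : (starRingEnd ℂ) x • ξ - y • η =
          (x * (starRingEnd ℂ) x + y * (starRingEnd ℂ) y) • a := by
        rw [hξ, hη]
        module
      rw [e, hsum, one_smul]
    have h2 : b = (starRingEnd ℂ) y • ξ + x • η := by
      have e : (starRingEnd ℂ) y • ξ + x • η =
          (x * (starRingEnd ℂ) x + y * (starRingEnd ℂ) y) • b := by
        rw [hξ, hη]
        module
      rw [e, hsum, one_smul]
    rw [mem_planeComplement]
    constructor
    · rw [h1, inner_sub_left, inner_smul_left, inner_smul_left, hw, hηw, mul_zero, mul_zero,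
        sub_zero]
    · rw [h2, inner_add_left, inner_smul_left, inner_smul_left, hw, hηw, mul_zero, mul_zero,
        add_zero]
  rw [volume_section hN hη1 (hE _ _) (mem_hyperplane_iff.2 hξη)
    (fun e he => mem_hyperplane_iff.2 (hE _ _ e he)) hH]
  have h := hqq (J (x, y)) hJ0
  change ∫⁻ e : (planeComplement a b).restrictScalars ℝ, ENNReal.ofReal ((N (η + e) ^ _)⁻¹) = _ at h
  rw [h, div_eq_mul_inv, ENNReal.ofReal_mul ENNReal.toReal_nonneg,
    ENNReal.ofReal_toReal (discMoment_ne_top d)]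

/-! ### The candidate functional is a complex norm -/

theorem hyperplane_smul {c : ℂ} (hc : c ≠ 0) (ξ : Cn n) : hyperplane (c • ξ) = hyperplane ξ := by
  ext z
  rw [mem_hyperplane_iff, mem_hyperplane_iff, inner_smul_left, mul_eq_zero, map_eq_zero]
  exact or_iff_right hc

/-- The Minkowski functional of the complex intersection body of `K`. -/
def sectionNorm (K : Set (Cn n)) (ξ : Cn n) : ℝ :=
  ‖ξ‖ * √(Real.pi / (sectionVolume K (hyperplane ξ)).toReal)

theorem sectionNorm_smul (K : Set (Cn n)) (c : ℂ) (ξ : Cn n) :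
    sectionNorm K (c • ξ) = ‖c‖ * sectionNorm K ξ := by
  by_cases hc : c = 0
  · simp [hc, sectionNorm]
  · rw [sectionNorm, hyperplane_smul hc, norm_smul, sectionNorm, mul_assoc]

theorem exists_plane_sectionNorm {N : Cn n → ℝ} (hN : IsComplexNorm N) {a b : Cn n}
    (ha : ‖a‖ = 1) (hb : ‖b‖ = 1) (hab : inner ℂ a b = 0) :
    ∃ Q : ℂ × ℂ → ℝ, IsNormLike Q ∧
      ∀ x y : ℂ, sectionNorm {z | N z ≤ 1} (x • a + y • b) = Q (x, y) := by
  obtain ⟨q, C, hC, hq, hqC⟩ := exists_plane_sectionVolume hN ha hb hab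
  have hs : 0 < √(Real.pi / C) := Real.sqrt_pos.2 (div_pos Real.pi_pos hC)
  refine ⟨fun u => √(Real.pi / C) * q u, hq.const_mul hs, fun x y => ?_⟩
  by_cases h0 : x • a + y • b = 0
  · obtain ⟨hx, hy⟩ := coeff_eq_zero ha hb hab (Submodule.zero_mem _) ((add_zero _).trans h0)
    rw [h0, hx, hy, show ((0 : ℂ), (0 : ℂ)) = 0 from rfl, sectionNorm, norm_zero,
      zero_mul]
    exact (hq.const_mul hs).map_zero.symm
  · set r := ‖x • a + y • b‖ with hr
    have hr0 : 0 < r := norm_pos_iff.2 h0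
    have hrc : (r : ℂ)⁻¹ ≠ 0 := by
      simpa using hr0.ne'
    have e : (r : ℂ)⁻¹ • (x • a + y • b) = ((r : ℂ)⁻¹ * x) • a + ((r : ℂ)⁻¹ * y) • b := by
      module
    have hn : ‖((r : ℂ)⁻¹ * x) • a + ((r : ℂ)⁻¹ * y) • b‖ = 1 := by
      rw [← e, norm_smul, norm_inv, Complex.norm_real, ← hr, Real.norm_of_nonneg hr0.le,
        inv_mul_cancel₀ hr0.ne']
    have h1 := hqC _ _ hn
    rw [← e, hyperplane_smul hrc] at h1
    have h2 : q ((r : ℂ)⁻¹ * x, (r : ℂ)⁻¹ * y) = r⁻¹ * q (x, y) := by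
      have := hq.smul r⁻¹ (x, y)
      rw [abs_of_pos (inv_pos.2 hr0)] at this
      rw [← this]
      congr 1
      ext1 <;> simp
    have hq0 : 0 < q (x, y) := by
      refine hq.pos _ fun h => h0 ?_
      rw [show x = 0 from congrArg Prod.fst h, show y = 0 from congrArg Prod.snd h]
      simp
    rw [sectionNorm, h1, h2, ENNReal.toReal_ofReal (by positivity), ← hr]
    have e2 : Real.pi / (C / (r⁻¹ * q (x, y)) ^ 2) = Real.pi / C * (r⁻¹ * q (x, y)) ^ 2 := by
      field_simp
    rw [e2, Real.sqrt_mul (by positivity), Real.sqrt_sq (by positivity)]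
    field_simp

theorem exists_unit_mem_span {S : Submodule ℂ (Cn n)} (hS : S ≠ ⊥) {w : Cn n} (hw : w ∈ S) :
    ∃ b ∈ S, ‖b‖ = 1 ∧ ∃ c : ℂ, w = c • b := by
  have key : ∀ v ∈ S, v ≠ 0 → ∃ b ∈ S, ‖b‖ = 1 ∧ ∃ c : ℂ, v = c • b := by
    intro v hv hv0
    have hn : (‖v‖ : ℂ) ≠ 0 := by exact_mod_cast (norm_pos_iff.2 hv0).ne'
    refine ⟨(‖v‖ : ℂ)⁻¹ • v, S.smul_mem _ hv, ?_, (‖v‖ : ℂ), (smul_inv_smul₀ hn v).symm⟩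
    rw [norm_smul, norm_inv, Complex.norm_real, norm_norm, inv_mul_cancel₀ (norm_ne_zero_iff.2 hv0)]
  by_cases hw0 : w = 0
  · obtain ⟨v, hv, hv0⟩ := S.ne_bot_iff.1 hS
    obtain ⟨b, hb, hb1, -⟩ := key v hv hv0
    exact ⟨b, hb, hb1, 0, by rw [hw0, zero_smul]⟩
  · exact key w hw hw0

/-- Gram–Schmidt, with an arbitrary unit vector supplied when a vector or its remainder vanishes; n
≥ 2 guarantees room for the second one. -/
theorem exists_orthonormal_pair (hn : 2 ≤ n) (ξ ζ : Cn n) :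
    ∃ a b : Cn n, ‖a‖ = 1 ∧ ‖b‖ = 1 ∧ inner ℂ a b = 0 ∧
      ξ ∈ Submodule.span ℂ {a, b} ∧ ζ ∈ Submodule.span ℂ {a, b} := by
  have hfin : Module.finrank ℂ (Cn n) = n := by simp
  have htop : (⊤ : Submodule ℂ (Cn n)) ≠ ⊥ := by
    intro h
    have := congrArg (fun S : Submodule ℂ (Cn n) => Module.finrank ℂ S) h
    simp only [finrank_top, finrank_bot, hfin] at this
    omega
  obtain ⟨a, -, ha, c, rfl⟩ := exists_unit_mem_span htop (Submodule.mem_top (x := ξ))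
  have ha0 : a ≠ 0 := by
    rintro rfl
    simp at ha
  have horth : (ℂ ∙ a)ᗮ ≠ ⊥ := by
    rw [Ne, Submodule.orthogonal_eq_bot_iff]
    intro h
    have := finrank_span_singleton (K := ℂ) ha0
    rw [h, finrank_top, hfin] at this
    omega
  have hζ : ζ - inner ℂ a ζ • a ∈ (ℂ ∙ a)ᗮ := by
    rw [Submodule.mem_orthogonal_singleton_iff_inner_right, inner_sub_right, inner_smul_right,
      inner_self_eq_one ha, mul_one, sub_self]
  obtain ⟨b, hb, hb1, c', hc'⟩ := exists_unit_mem_span horth hζ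
  refine ⟨a, b, ha, hb1, Submodule.mem_orthogonal_singleton_iff_inner_right.1 hb,
    Submodule.mem_span_pair.2 ⟨c, 0, by rw [zero_smul, add_zero]⟩,
    Submodule.mem_span_pair.2 ⟨inner ℂ a ζ, c', ?_⟩⟩
  rw [← hc', add_sub_cancel]

/-- The hyperplane is a point; its volume is 1, as for the parallelepiped on an empty orthonormal
basis. -/
theorem sectionVolume_of_le_one (hn : n ≤ 1) {K : Set (Cn n)} (hK : 0 ∈ K) {ξ : Cn n}
    (hξ : ξ ≠ 0) : sectionVolume K (hyperplane ξ) = 1 := by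
  have hspan : (ℂ ∙ ξ) = ⊤ := by
    refine Submodule.eq_top_of_finrank_eq (le_antisymm (Submodule.finrank_le _) ?_)
    rw [finrank_span_singleton hξ]
    simpa using hn
  have hbot : hyperplane ξ = ⊥ := by rw [hyperplane_eq, hspan, Submodule.top_orthogonal_eq_bot]
  have hzero : ∀ w : (hyperplane ξ).restrictScalars ℝ, (w : Cn n) = 0 := fun w =>
    (Submodule.mem_bot ℂ).1 (hbot.le w.2)
  have hsub : Subsingleton ((hyperplane ξ).restrictScalars ℝ) :=
    ⟨fun v w => Subtype.ext ((hzero v).trans (hzero w).symm)⟩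
  have huniv : {w : (hyperplane ξ).restrictScalars ℝ | (w : Cn n) ∈ K} =
      parallelepiped (stdOrthonormalBasis ℝ ((hyperplane ξ).restrictScalars ℝ)) := by
    ext w
    refine ⟨fun _ => ?_, fun _ => ?_⟩
    · rw [mem_parallelepiped_iff]
      exact ⟨0, ⟨le_rfl, zero_le_one⟩, Subsingleton.elim _ _⟩
    · rw [Set.mem_ofPred_eq, hzero w]
      exact hK
  rw [sectionVolume, huniv, OrthonormalBasis.volume_parallelepiped]

theorem isComplexNorm_sectionNorm {N : Cn n → ℝ} (hN : IsComplexNorm N) :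
    IsComplexNorm (sectionNorm {z | N z ≤ 1}) := by
  by_cases hn : 2 ≤ n
  · refine ⟨fun ξ ζ => ?_, sectionNorm_smul _, fun ξ hξ => ?_⟩
    · obtain ⟨a, b, ha, hb, hab, h1, h2⟩ := exists_orthonormal_pair hn ξ ζ
      obtain ⟨x, y, rfl⟩ := Submodule.mem_span_pair.1 h1
      obtain ⟨z, w, rfl⟩ := Submodule.mem_span_pair.1 h2
      obtain ⟨Q, hQ, hQe⟩ := exists_plane_sectionNorm hN ha hb hab
      have e : x • a + y • b + (z • a + w • b) = (x + z) • a + (y + w) • b := by module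
      rw [e, hQe, hQe, hQe]
      exact hQ.add_le (x, y) (z, w)
    · obtain ⟨a, b, ha, hb, hab, h1, -⟩ := exists_orthonormal_pair hn ξ ξ
      obtain ⟨x, y, rfl⟩ := Submodule.mem_span_pair.1 h1
      obtain ⟨Q, hQ, hQe⟩ := exists_plane_sectionNorm hN ha hb hab
      rw [hQe]
      refine hQ.pos _ fun h => hξ ?_
      rw [show x = 0 from congrArg Prod.fst h, show y = 0 from congrArg Prod.snd h]
      simp
  · have key : ∀ ξ : Cn n, sectionNorm {z | N z ≤ 1} ξ = ‖ξ‖ * √Real.pi := by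
      intro ξ
      by_cases hξ : ξ = 0
      · simp [hξ, sectionNorm]
      · rw [sectionNorm, sectionVolume_of_le_one (by omega)
          (by simp [hN.isNormLike.map_zero]) hξ]
        simp
    refine ⟨fun ξ ζ => ?_, sectionNorm_smul _, fun ξ hξ => ?_⟩
    · rw [key, key, key, ← add_mul]
      gcongr
      exact norm_add_le ξ ζ
    · rw [key]
      have := norm_pos_iff.2 hξ
      have := Real.pi_pos
      positivity

theorem sectionVolume_hyperplane {N : Cn n → ℝ} (hN : IsComplexNorm N) {ξ : Cn n} (hξ : ‖ξ‖ = 1) :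
    sectionVolume {z | N z ≤ 1} (hyperplane ξ) =
      ENNReal.ofReal (Real.pi / sectionNorm {z | N z ≤ 1} ξ ^ 2) := by
  have hξ0 : ξ ≠ 0 := by
    rintro rfl
    simp at hξ
  have hpos := (isComplexNorm_sectionNorm hN).pos ξ hξ0
  rw [sectionNorm, hξ, one_mul] at hpos ⊢
  set v := sectionVolume {z | N z ≤ 1} (hyperplane ξ)
  have h1 : 0 < Real.pi / v.toReal := Real.sqrt_pos.1 hpos
  -- Positivity of the norm excludes volumes 0 and ∞ at once: both have `toReal` equal to 0, and
  -- division by 0 would make the norm vanish.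
  have h2 : v.toReal ≠ 0 := by
    intro h
    rw [h, div_zero] at h1
    exact lt_irrefl _ h1
  have h3 : v ≠ ⊤ := by
    intro h
    rw [h] at h2
    exact h2 rfl
  rw [Real.sq_sqrt h1.le, div_div_cancel₀ Real.pi_ne_zero, ENNReal.ofReal_toReal h3]

end ComplexBody

end

/-! ### Existence, uniqueness and convexity of the complex intersection body -/

theorem mainTheorem1 (n : ℕ) (K : Set (ComplexBody.Cn n))
    (hK : ComplexBody.IsSymmComplexConvexBody K) :
    (∃! L : Set (ComplexBody.Cn n), ComplexBody.IsComplexIntersectionBodyOf L K) ∧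
      ∀ L : Set (ComplexBody.Cn n), ComplexBody.IsComplexIntersectionBodyOf L K →
        ComplexBody.IsSymmComplexConvexBody L := by
  have hKs := hK.isSymmComplexStarBody
  have hN := hK.isComplexNorm_gauge
  have hKN : {z | gauge K z ≤ 1} = K := Set.ext fun z => hKs.isStarBody.gauge_le_one_iff
  have hM := ComplexBody.isComplexNorm_sectionNorm hN
  have hvol := fun (ξ : ComplexBody.Cn n) (hξ : ‖ξ‖ = 1) =>
    ComplexBody.sectionVolume_hyperplane hN hξ
  rw [hKN] at hM
  simp only [hKN] at hvol
  have hLc := hM.isSymmComplexConvexBody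
  have hex : ComplexBody.IsComplexIntersectionBodyOf
      {z | ComplexBody.sectionNorm K z ≤ 1} K := by
    refine ⟨hLc.isSymmComplexStarBody, hKs, fun ξ hξ => ?_⟩
    rw [hLc.isSymmComplexStarBody.sectionVolume_line hξ, hM.gauge_unitBall, hvol ξ hξ]
  have huniq : ∀ L, ComplexBody.IsComplexIntersectionBodyOf L K →
      L = {z | ComplexBody.sectionNorm K z ≤ 1} := by
    intro L hL
    -- Equal disc areas give equal functionals on the unit sphere. Complex homogeneity extends this
    -- to all vectors, and a star body is recovered from its functional.
    have hunit : ∀ ξ : ComplexBody.Cn n, ‖ξ‖ = 1 → gauge L ξ = ComplexBody.sectionNorm K ξ := by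
      intro ξ hξ
      have hξ0 : ξ ≠ 0 := by
        rintro rfl
        simp at hξ
      have hg := hL.left.isStarBody.gauge_pos hξ0
      have hm := hM.pos ξ hξ0
      have h := hL.volume_eq ξ hξ
      have := Real.pi_pos
      rw [hL.left.sectionVolume_line hξ, hvol ξ hξ,
        ENNReal.ofReal_eq_ofReal_iff (by positivity) (by positivity),
        div_eq_mul_inv, div_eq_mul_inv] at h
      exact (pow_left_inj₀ hg.le hm.le two_ne_zero).1
        (inv_injective (mul_left_cancel₀ Real.pi_ne_zero h))
    ext z
    rw [← hL.left.isStarBody.gauge_le_one_iff, Set.mem_ofPred_eq]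
    by_cases hz : z = 0
    · rw [hz, gauge_zero, hM.isNormLike.map_zero]
    · have hz' : 0 < ‖z‖ := norm_pos_iff.2 hz
      have e : z = (‖z‖ : ℂ) • ((‖z‖ : ℂ)⁻¹ • z) := by
        rw [smul_inv_smul₀]
        exact_mod_cast hz'.ne'
      have hu : ‖(‖z‖ : ℂ)⁻¹ • z‖ = 1 := by
        rw [norm_smul, norm_inv, Complex.norm_real, norm_norm, inv_mul_cancel₀ hz'.ne']
      rw [e, ComplexBody.gauge_complex_smul hL.left.rotation, hM.smul, hunit _ hu]
  refine ⟨⟨_, hex, huniq⟩, fun L hL => ?_⟩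
  rw [huniq L hL]
  exact hLc
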